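/- Let $T>0$, let $\Delta=\{(t_1,t_2)\in\mathbb R^2 : 0\le t_1\le t_2\le T\}$, and let $(\Omega,\mathcal F,P)$ be a probability space. For each positive integer $N$ and $i=1,\dots,N$, let $w^{(N)}_i:\Delta\to[0,\infty)$ be continuously differentiable, and let $0=\tau^{(N)}_{i,0}<\tau^{(N)}_{i,1}<\tau^{(N)}_{i,2}<\cdots$ be random times with values in $[0,\infty]$ (strictly increasing as long as they are finite, and equal to $\infty$ from then on) such that, for every $k\ge1$ and $t\in[0,T]$, almost surely $$P\bigl(t<\tau^{(N)}_{i,k}\,\big|\,\sigma(\tau^{(N)}_{i,0},\dots,\tau^{(N)}_{i,k-1})\bigr)=\exp\Bigl(-\int_{\tau^{(N)}_{i,k-1}}^{t}w^{(N)}_i(\tau^{(N)}_{i,k-1},u)\,du\Bigr)\quad\text{on }\{\tau^{(N)}_{i,k-1}\le t\}.$$ Let $Z^{(N)}_i(t)=\max\{k\ge0:\tau^{(N)}_{i,k}\le t\}$, $t\in[0,T]$, be the associated counting process, and put $Z^{(N)}_i(t_1,t_2)=Z^{(N)}_i(t_2)-Z^{(N)}_i(t_1)$ for $(t_1,t_2)\in\Delta$.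 Assume that for each $N$ the processes $Z^{(N)}_1,\dots,Z^{(N)}_N$ on $[0,T]$ are independent (nothing is assumed about the joint law for different $N$), and that $$\sup_{N\ge1,\ 1\le i\le N}\ \sup_{(t_1,t_2)\in\Delta}w^{(N)}_i(t_1,t_2)<\infty .$$ Then, almost surely, only finitely many of the times $\tau^{(N)}_{i,k}$, $k\ge0$, lie in $[0,T]$ for every $N$ and $i$ (so that the maxima above exist), each $Z^{(N)}_i(t)$ with $t\in[0,T]$ is integrable, and $$\lim_{N\to\infty}\ \sup_{(t_1,t_2)\in\Delta}\Bigl|\frac1N\sum_{i=1}^N\bigl(Z^{(N)}_i(t_1,t_2)-E[Z^{(N)}_i(t_1,t_2)]\bigr)\Bigr|=0\qquad\text{almost surely}.$$ -/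

import Mathlib

open MeasureTheory ProbabilityTheory Filter Topology
open scoped ENNReal

/-- The triangle `{(t₁, t₂) : 0 ≤ t₁ ≤ t₂ ≤ T}`. -/
def timeTriangle (T : ℝ) : Set (ℝ × ℝ) :=
  {p | 0 ≤ p.1 ∧ p.1 ≤ p.2 ∧ p.2 ≤ T}

/-- The history of the arrivals up to and including the `k`-th one, `σ(τ₀, …, τₖ)`. -/
@[reducible] def arrivalHistory {Ω : Type*} (τ : ℕ → Ω → ℝ≥0∞) (k : ℕ) : MeasurableSpace Ω :=
  ⨆ j : ℕ, ⨆ _ : j ≤ k, MeasurableSpace.comap (τ j) inferInstance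

/-- The random times `0 = τ₀ < τ₁ < ⋯` are arrival times whose intensity `w (τₖ, u)` at time
`u ≤ T` depends on the last arrival time `τₖ` before `u`.  The value `∞` is allowed
and means that the arrival in question never happens (`w` says nothing about times after `T`). -/
structure IsLastArrivalDependent {Ω : Type*} [MeasurableSpace Ω] (μ : Measure Ω) (T : ℝ)
    (w : ℝ → ℝ → ℝ) (τ : ℕ → Ω → ℝ≥0∞) : Prop where
  measurable : ∀ k, Measurable (τ k)
  zero : ∀ᵐ ω ∂μ, τ 0 ω = 0
  mono : ∀ᵐ ω ∂μ, ∀ k, τ k ω ≤ τ (k + 1) ω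
  strict : ∀ᵐ ω ∂μ, ∀ k, τ k ω ≠ ∞ → τ k ω < τ (k + 1) ω
  /-- `P(t < τₖ₊₁ | τ₀, …, τₖ) = exp (-∫_{τₖ}^t w(τₖ, u) du)` on `{τₖ ≤ t}`, for `t ∈ [0, T]`. -/
  survival : ∀ k : ℕ, ∀ t ∈ Set.Icc 0 T, ∀ᵐ ω ∂μ, τ k ω ≤ ENNReal.ofReal t →
    (μ⟦{ω' | ENNReal.ofReal t < τ (k + 1) ω'} | arrivalHistory τ k⟧) ω
      = Real.exp (-∫ u in (τ k ω).toReal..t, w (τ k ω).toReal u)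

/-- The counting process `Z(t) = max {k : τₖ ≤ t}`. The supremum in `ℕ` is the maximum if the
set is nonempty and finite, and `0` otherwise. -/
noncomputable def countingProcess {Ω : Type*} (τ : ℕ → Ω → ℝ≥0∞) (t : ℝ) (ω : Ω) : ℕ :=
  sSup {k : ℕ | τ k ω ≤ ENNReal.ofReal t}

/-- The number of arrivals in the interval `(t₁, t₂]`, as a real number: `Z(t₂) - Z(t₁)`. -/
noncomputable def countingIncrement {Ω : Type*} (τ : ℕ → Ω → ℝ≥0∞) (t₁ t₂ : ℝ) (ω : Ω) : ℝ :=
  (countingProcess τ t₂ ω : ℝ) - (countingProcess τ t₁ ω : ℝ)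

/-! ### Short-interval and tail estimates for the arrival times. -/

section ArrivalTimes

/-! An intensity bounded by `C` lets the next arrival fall in `(s, t]` only with conditional
probability at most `C * (t - s)`, and only if the previous arrival is no later than `t`
(`measureReal_Ioc_le`). Iterating over a fine grid gives a tail `P(τₖ ≤ t) ≤ K 2⁻ᵏ`, where `K`
depends only on `C` and `T` (`exists_tail_bound`). This one estimate yields finiteness of the
arrivals by Borel–Cantelli, fourth moments of the counts bounded uniformly in `N` and `i`, and
Lipschitz means (`integral_countingIncrement_le`).

At a fixed time, the centred row average has fourth moment `O(N⁻²)`. This is summable, so the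
averages tend to zero almost surely whatever the joint law of different rows
(`ae_tendsto_average_of_pow_four_le`).

To pass to all times, this is applied on countably many grid points. Between them the averaged
counts are monotone and their means vary little, so a Pólya-type sandwich gives uniformity in `t`
(`eventually_forall_abs_sub_le`). Increments are differences of two such values. -/

theorem measurable_arrivalHistory {Ω : Type*} (τ : ℕ → Ω → ℝ≥0∞) (k : ℕ) :
    Measurable[arrivalHistory τ k] (τ k) :=
  Measurable.mono (comap_measurable (τ k))
    (le_iSup₂_of_le (f := fun j (_ : j ≤ k) => MeasurableSpace.comap (τ j) inferInstance)
      k le_rfl le_rfl) le_rfl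

variable {Ω : Type*} [mΩ : MeasurableSpace Ω] {μ : Measure Ω} {T C : ℝ} {w : ℝ → ℝ → ℝ}
  {τ : ℕ → Ω → ℝ≥0∞}

theorem arrivalHistory_le (h : ∀ k, Measurable (τ k)) (k : ℕ) : arrivalHistory τ k ≤ mΩ :=
  iSup₂_le fun j _ => (h j).comap_le

theorem intervalIntegrable_intensity
    (hw : ContinuousOn (fun p : ℝ × ℝ => w p.1 p.2) (timeTriangle T))
    {a s t : ℝ} (ha : 0 ≤ a) (has : a ≤ s) (hst : s ≤ t) (htT : t ≤ T) :
    IntervalIntegrable (w a) volume s t := by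
  apply ContinuousOn.intervalIntegrable
  rw [Set.uIcc_of_le hst]
  exact hw.comp (f := fun u : ℝ => (a, u)) (by fun_prop)
    fun u hu => ⟨ha, has.trans hu.1, hu.2.trans htT⟩

theorem integral_intensity_nonneg
    (hw0 : ∀ p ∈ timeTriangle T, 0 ≤ w p.1 p.2)
    {a s t : ℝ} (ha : 0 ≤ a) (has : a ≤ s) (hst : s ≤ t) (htT : t ≤ T) :
    0 ≤ ∫ u in s..t, w a u :=
  intervalIntegral.integral_nonneg hst fun u hu =>
    hw0 (a, u) ⟨ha, has.trans hu.1, hu.2.trans htT⟩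

theorem integral_intensity_le
    (hw : ContinuousOn (fun p : ℝ × ℝ => w p.1 p.2) (timeTriangle T))
    (hwC : ∀ p ∈ timeTriangle T, w p.1 p.2 ≤ C)
    {a s t : ℝ} (ha : 0 ≤ a) (has : a ≤ s) (hst : s ≤ t) (htT : t ≤ T) :
    ∫ u in s..t, w a u ≤ C * (t - s) := by
  have := intervalIntegral.integral_mono_on hst
    (intervalIntegrable_intensity hw ha has hst htT) (intervalIntegrable_const (c := C))
    fun u hu => hwC (a, u) ⟨ha, has.trans hu.1, hu.2.trans htT⟩
  rwa [intervalIntegral.integral_const, smul_eq_mul, mul_comm] at this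

/-- The survival function decreases by at most `C * (t - s)` between `s` and `t`. -/
theorem exp_neg_integral_intensity_sub_le
    (hw : ContinuousOn (fun p : ℝ × ℝ => w p.1 p.2) (timeTriangle T))
    (hw0 : ∀ p ∈ timeTriangle T, 0 ≤ w p.1 p.2)
    (hwC : ∀ p ∈ timeTriangle T, w p.1 p.2 ≤ C)
    {a s t : ℝ} (ha : 0 ≤ a) (has : a ≤ s) (hst : s ≤ t) (htT : t ≤ T) :
    Real.exp (-∫ u in a..s, w a u) - Real.exp (-∫ u in a..t, w a u) ≤ C * (t - s) := by
  have hadd := intervalIntegral.integral_add_adjacent_intervals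
    (intervalIntegrable_intensity hw ha le_rfl has (hst.trans htT))
    (intervalIntegrable_intensity hw ha has hst htT)
  have h0 := integral_intensity_nonneg hw0 ha le_rfl has (hst.trans htT)
  have h1 := integral_intensity_nonneg hw0 ha has hst htT
  have h2 := integral_intensity_le hw hwC ha has hst htT
  -- Factor the difference as `exp(-A) * (1 - exp(-B))`, with `B` the integral over `[s, t]`, and
  -- use `1 - exp(-B) ≤ B`.
  rw [← hadd, neg_add, Real.exp_add]
  have h3 : Real.exp (-∫ u in a..s, w a u) ≤ 1 := Real.exp_le_one_iff.2 (by linarith)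
  have h4 := Real.one_sub_le_exp_neg (∫ u in s..t, w a u)
  have h5 := Real.exp_pos (-∫ u in a..s, w a u)
  nlinarith

variable [IsProbabilityMeasure μ]

/-- If `τₖ ≤ s`, both survival formulas apply. If `s < τₖ ≤ t`, the formula at `s` is unavailable;
the trivial bound `1` replaces it, and the intensity acts only on `[τₖ, t]`, which is shorter than
`[s, t]`. -/
theorem IsLastArrivalDependent.condExp_sub_le (h : IsLastArrivalDependent μ T w τ)
    (hw : ContinuousOn (fun p : ℝ × ℝ => w p.1 p.2) (timeTriangle T))
    (hw0 : ∀ p ∈ timeTriangle T, 0 ≤ w p.1 p.2)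
    (hwC : ∀ p ∈ timeTriangle T, w p.1 p.2 ≤ C) (hC : 0 ≤ C)
    (k : ℕ) {s t : ℝ} (hs : 0 ≤ s) (hst : s ≤ t) (htT : t ≤ T) :
    ∀ᵐ ω ∂μ, τ k ω ≤ ENNReal.ofReal t →
      (μ⟦{ω' | ENNReal.ofReal s < τ (k + 1) ω'} | arrivalHistory τ k⟧) ω
        - (μ⟦{ω' | ENNReal.ofReal t < τ (k + 1) ω'} | arrivalHistory τ k⟧) ω ≤ C * (t - s) := by
  have hms : MeasurableSet {ω' | ENNReal.ofReal s < τ (k + 1) ω'} :=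
    measurableSet_lt measurable_const (h.measurable _)
  have hle : (μ⟦{ω' | ENNReal.ofReal s < τ (k + 1) ω'} | arrivalHistory τ k⟧) ≤ᵐ[μ]
      fun _ => (1 : ℝ) := by
    have hconst := condExp_const (arrivalHistory_le h.measurable k) (1 : ℝ) (μ := μ)
    refine (condExp_mono ((integrable_const (1 : ℝ)).indicator hms) (integrable_const 1)
      (Eventually.of_forall fun ω => ?_)).trans_eq (Eventually.of_forall (congrFun hconst))
    exact Set.indicator_le_self' (fun _ _ => zero_le_one) ω
  filter_upwards [hle, h.survival k s ⟨hs, hst.trans htT⟩, h.survival k t ⟨hs.trans hst, htT⟩]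
    with ω h1 h2 h3 hω
  rw [h3 hω]
  have ha : 0 ≤ (τ k ω).toReal := ENNReal.toReal_nonneg
  have hat : (τ k ω).toReal ≤ t := by
    simpa [ENNReal.toReal_ofReal (hs.trans hst)] using ENNReal.toReal_mono ENNReal.ofReal_ne_top hω
  rcases le_or_gt (τ k ω) (ENNReal.ofReal s) with hle | hlt
  · rw [h2 hle]
    refine exp_neg_integral_intensity_sub_le hw hw0 hwC ha ?_ hst htT
    simpa [ENNReal.toReal_ofReal hs] using ENNReal.toReal_mono ENNReal.ofReal_ne_top hle
  · have hsa : s ≤ (τ k ω).toReal :=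
      (ENNReal.ofReal_le_iff_le_toReal (ne_top_of_le_ne_top ENNReal.ofReal_ne_top hω)).1 hlt.le
    have h4 := Real.one_sub_le_exp_neg (∫ u in (τ k ω).toReal..t, w (τ k ω).toReal u)
    have h5 := integral_intensity_le hw hwC ha le_rfl hat htT
    have h6 : C * (t - (τ k ω).toReal) ≤ C * (t - s) := by gcongr
    linarith

theorem IsLastArrivalDependent.measureReal_Ioc_le (h : IsLastArrivalDependent μ T w τ)
    (hw : ContinuousOn (fun p : ℝ × ℝ => w p.1 p.2) (timeTriangle T))
    (hw0 : ∀ p ∈ timeTriangle T, 0 ≤ w p.1 p.2)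
    (hwC : ∀ p ∈ timeTriangle T, w p.1 p.2 ≤ C) (hC : 0 ≤ C)
    (k : ℕ) {s t : ℝ} (hs : 0 ≤ s) (hst : s ≤ t) (htT : t ≤ T) :
    μ.real {ω | ENNReal.ofReal s < τ (k + 1) ω ∧ τ (k + 1) ω ≤ ENNReal.ofReal t}
      ≤ C * (t - s) * μ.real {ω | τ k ω ≤ ENNReal.ofReal t} := by
  set A : Set Ω := {ω | τ k ω ≤ ENNReal.ofReal t} with hA
  have hm := arrivalHistory_le h.measurable k
  have hAm' : MeasurableSet[arrivalHistory τ k] A :=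
    measurable_arrivalHistory τ k measurableSet_Iic
  have hAm : MeasurableSet A := hm _ hAm'
  have hmeas : ∀ r : ℝ, MeasurableSet {ω' | ENNReal.ofReal r < τ (k + 1) ω'} := fun r =>
    measurableSet_lt measurable_const (h.measurable _)
  have hint : ∀ r : ℝ,
      ∫ ω in A, (μ⟦{ω' | ENNReal.ofReal r < τ (k + 1) ω'} | arrivalHistory τ k⟧) ω ∂μ
        = μ.real (A ∩ {ω' | ENNReal.ofReal r < τ (k + 1) ω'}) := fun r => by
    rw [setIntegral_condExp hm ((integrable_const 1).indicator (hmeas r)) hAm',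
      setIntegral_indicator (hmeas r)]
    simp
  have hsub : ∫ ω in A, ((μ⟦{ω' | ENNReal.ofReal s < τ (k + 1) ω'} | arrivalHistory τ k⟧) ω
        - (μ⟦{ω' | ENNReal.ofReal t < τ (k + 1) ω'} | arrivalHistory τ k⟧) ω) ∂μ
      ≤ ∫ _ω in A, C * (t - s) ∂μ := by
    refine setIntegral_mono_on_ae (integrable_condExp.sub integrable_condExp).integrableOn
      (integrable_const _).integrableOn hAm ?_
    exact h.condExp_sub_le hw hw0 hwC hC k hs hst htT
  rw [integral_sub integrable_condExp.integrableOn integrable_condExp.integrableOn, hint, hint,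
    setIntegral_const, smul_eq_mul, mul_comm] at hsub
  have hss : A ∩ {ω' | ENNReal.ofReal t < τ (k + 1) ω'}
      ⊆ A ∩ {ω' | ENNReal.ofReal s < τ (k + 1) ω'} := fun ω hω =>
    ⟨hω.1, (ENNReal.ofReal_le_ofReal hst).trans_lt hω.2⟩
  rw [← measureReal_sdiff hss (hAm.inter (hmeas t))] at hsub
  refine le_trans (le_of_eq ?_) hsub
  -- Since `τₖ ≤ τₖ₊₁` almost surely, the event already lies in `A` up to a null set, so it is the
  -- difference of the two survival events within `A`.
  refine measureReal_congr ?_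
  filter_upwards [h.mono] with ω hω
  refine propext ⟨fun h' => ⟨⟨(hω k).trans h'.2, h'.1⟩, fun h'' => h''.2.not_ge h'.2⟩,
    fun h' => ⟨h'.1.2, not_lt.1 fun h'' => h'.2 ⟨h'.1.1, h''⟩⟩⟩

/-- Double induction. With `a(k, j)` the probability, the short-interval estimate gives `a(k+1, j+1)
≤ a(k+1, j) + a(k, j+1) / 4`, and `2 ^ j * (1 / 2) ^ k` solves this recursion with equality. -/
theorem IsLastArrivalDependent.measureReal_le_grid (h : IsLastArrivalDependent μ T w τ)
    (hw : ContinuousOn (fun p : ℝ × ℝ => w p.1 p.2) (timeTriangle T))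
    (hw0 : ∀ p ∈ timeTriangle T, 0 ≤ w p.1 p.2)
    (hwC : ∀ p ∈ timeTriangle T, w p.1 p.2 ≤ C) (hC : 0 ≤ C)
    {δ : ℝ} (hδ : 0 ≤ δ) (hCδ : C * δ ≤ 1 / 4) (k j : ℕ) (hj : j * δ ≤ T) :
    μ.real {ω | τ k ω ≤ ENNReal.ofReal (j * δ)} ≤ 2 ^ j * (1 / 2) ^ k := by
  induction k generalizing j with
  | zero =>
    rw [pow_zero, mul_one]
    exact measureReal_le_one.trans (one_le_pow₀ one_le_two)
  | succ k ihk =>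
    induction j with
    | zero =>
      -- At time `0` only `τ₀` has occurred: almost surely `τₖ₊₁ ≥ τ₁ > 0`.
      have : μ.real {ω | τ (k + 1) ω ≤ ENNReal.ofReal ((0 : ℕ) * δ)} = 0 := by
        rw [measureReal_eq_zero_iff]
        refine measure_mono_null (t := {ω | ¬ (0 < τ (k + 1) ω)}) (fun ω hω => ?_) ?_
        · simpa using hω
        · refine ae_iff.1 ?_
          filter_upwards [h.zero, h.mono, h.strict] with ω h0 hm hs
          exact (h0 ▸ hs 0 (by simp [h0])).trans_le
            (monotone_nat_of_le_succ (f := fun k => τ k ω) hm (Nat.succ_le_succ k.zero_le))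
      rw [this]; positivity
    | succ j ihj =>
      have hjj : (j : ℝ) * δ ≤ ((j + 1 : ℕ) : ℝ) * δ := by push_cast; nlinarith
      have h1 := ihj (hjj.trans hj)
      have h2 := h.measureReal_Ioc_le hw hw0 hwC hC k (by positivity) hjj hj
      have h3 := ihk (j + 1) hj
      have h4 : μ.real {ω | τ (k + 1) ω ≤ ENNReal.ofReal ((j + 1 : ℕ) * δ)}
          ≤ μ.real {ω | τ (k + 1) ω ≤ ENNReal.ofReal (j * δ)}
            + μ.real {ω | ENNReal.ofReal (j * δ) < τ (k + 1) ω
                ∧ τ (k + 1) ω ≤ ENNReal.ofReal ((j + 1 : ℕ) * δ)} := by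
        refine le_trans (measureReal_mono fun ω hω => ?_) (measureReal_union_le _ _)
        exact (le_or_gt (τ (k + 1) ω) (ENNReal.ofReal (j * δ))).imp id fun h' => ⟨h', hω⟩
      have h5 : C * (((j + 1 : ℕ) : ℝ) * δ - j * δ) = C * δ := by push_cast; ring
      rw [h5] at h2
      have h6 : C * δ * μ.real {ω | τ k ω ≤ ENNReal.ofReal ((j + 1 : ℕ) * δ)}
          ≤ 1 / 4 * (2 ^ (j + 1) * (1 / 2) ^ k) := by gcongr
      calc _ ≤ 2 ^ j * (1 / 2) ^ (k + 1) + 1 / 4 * (2 ^ (j + 1) * (1 / 2) ^ k) :=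
            h4.trans (add_le_add h1 (h2.trans h6))
        _ = 2 ^ (j + 1) * (1 / 2) ^ (k + 1) := by ring

end ArrivalTimes

/-! ### Measurability, moments and mean increments of the counting process. -/

section CountingProcess

theorem countingProcess_eq_zero_or_le {Ω : Type*} (τ : ℕ → Ω → ℝ≥0∞) (t : ℝ) (ω : Ω) :
    countingProcess τ t ω = 0 ∨ τ (countingProcess τ t ω) ω ≤ ENNReal.ofReal t := by
  by_cases hb : BddAbove {k : ℕ | τ k ω ≤ ENNReal.ofReal t}
  · rcases Set.eq_empty_or_nonempty {k : ℕ | τ k ω ≤ ENNReal.ofReal t} with he | hne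
    · left; rw [countingProcess, he]; exact csSup_empty
    · right; exact Nat.sSup_mem hne hb
  · left; rw [countingProcess, csSup_of_not_bddAbove hb]; exact csSup_empty

theorem countingProcess_mono {Ω : Type*} {τ : ℕ → Ω → ℝ≥0∞} {s t : ℝ} {ω : Ω} (hst : s ≤ t)
    (hfin : {k : ℕ | τ k ω ≤ ENNReal.ofReal t}.Finite) :
    countingProcess τ s ω ≤ countingProcess τ t ω := by
  rcases countingProcess_eq_zero_or_le τ s ω with h | h
  · rw [h]; exact Nat.zero_le _
  · exact le_csSup hfin.bddAbove (h.trans (ENNReal.ofReal_le_ofReal hst))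

/-- The number of arrivals in `(s, t]` is at most `∑ₖ 1{s < τₖ₊₁ ≤ t}`. -/
theorem ofReal_countingIncrement_le {Ω : Type*} {τ : ℕ → Ω → ℝ≥0∞} {s t : ℝ} {ω : Ω} (hst : s ≤ t)
    (hmono : ∀ k, τ k ω ≤ τ (k + 1) ω) (hfin : {k : ℕ | τ k ω ≤ ENNReal.ofReal t}.Finite) :
    ENNReal.ofReal (countingIncrement τ s t ω)
      ≤ ∑' k : ℕ, {ω | ENNReal.ofReal s < τ (k + 1) ω ∧ τ (k + 1) ω ≤ ENNReal.ofReal t}.indicator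
          (fun _ => (1 : ℝ≥0∞)) ω := by
  have hle := countingProcess_mono (τ := τ) hst hfin
  have hfins : {k : ℕ | τ k ω ≤ ENNReal.ofReal s}.Finite :=
    hfin.subset fun k hk => le_trans hk (ENNReal.ofReal_le_ofReal hst)
  have hmem : ∀ k ∈ Finset.Ico (countingProcess τ s ω) (countingProcess τ t ω),
      ENNReal.ofReal s < τ (k + 1) ω ∧ τ (k + 1) ω ≤ ENNReal.ofReal t := by
    intro k hk
    rw [Finset.mem_Ico] at hk
    refine ⟨not_le.1 fun hk' => ?_, ?_⟩
    · have := le_csSup hfins.bddAbove hk'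
      exact absurd (this.trans hk.1) (by omega)
    · rcases countingProcess_eq_zero_or_le τ t ω with h0 | h0
      · omega
      · exact (monotone_nat_of_le_succ (f := fun k => τ k ω) hmono
          (Nat.succ_le_of_lt hk.2)).trans h0
  refine le_trans (le_of_eq ?_) (ENNReal.sum_le_tsum
    (Finset.Ico (countingProcess τ s ω) (countingProcess τ t ω)))
  rw [Finset.sum_congr rfl fun k hk => Set.indicator_of_mem (by exact hmem k hk) _]
  rw [Finset.sum_const, Nat.card_Ico, nsmul_one, countingIncrement, ← Nat.cast_sub hle,
    ENNReal.ofReal_natCast]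

variable {Ω : Type*} [MeasurableSpace Ω] {μ : Measure Ω} {T C : ℝ} {w : ℝ → ℝ → ℝ}
  {τ : ℕ → Ω → ℝ≥0∞}

theorem measurable_countingProcess (h : ∀ k, Measurable (τ k)) (t : ℝ) :
    Measurable (countingProcess τ t) := by
  refine measurable_of_Iic fun n => ?_
  -- The first alternative is the unbounded case, where the supremum in `ℕ` takes the default value
  -- `0`.
  have hset : countingProcess τ t ⁻¹' Set.Iic n
      = {ω | (∀ m : ℕ, ∃ k : ℕ, m < k ∧ τ k ω ≤ ENNReal.ofReal t)
          ∨ ∀ k : ℕ, τ k ω ≤ ENNReal.ofReal t → k ≤ n} := by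
    ext ω
    simp only [Set.mem_preimage, Set.mem_Iic, Set.mem_ofPred_eq]
    by_cases hb : BddAbove {k : ℕ | τ k ω ≤ ENNReal.ofReal t}
    · have hnot : ¬ ∀ m : ℕ, ∃ k : ℕ, m < k ∧ τ k ω ≤ ENNReal.ofReal t := by
        obtain ⟨m, hm⟩ := hb
        intro hall
        obtain ⟨k, hk, hk'⟩ := hall m
        exact hk.not_ge (hm hk')
      rw [or_iff_right hnot]
      refine ⟨fun hZ k hk => (le_csSup hb hk).trans hZ, fun hk => ?_⟩
      rcases countingProcess_eq_zero_or_le τ t ω with h0 | h0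
      · rw [h0]; exact Nat.zero_le _
      · exact hk _ h0
    · have h0 : countingProcess τ t ω = 0 := by
        rw [countingProcess, csSup_of_not_bddAbove hb]; exact csSup_empty
      rw [h0]
      refine iff_of_true (Nat.zero_le _) (Or.inl fun m => ?_)
      obtain ⟨k, hk, hmk⟩ := not_bddAbove_iff.1 hb m
      exact ⟨k, hmk, hk⟩
  have hmeas : ∀ k, MeasurableSet {ω | τ k ω ≤ ENNReal.ofReal t} := fun k =>
    measurableSet_le (h k) measurable_const
  rw [hset, Set.ofPred_or]
  refine MeasurableSet.union ?_ ?_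
  · simp only [Set.ofPred_forall, Set.ofPred_exists, Set.ofPred_and]
    exact .iInter fun m => .iUnion fun k => (MeasurableSet.const _).inter (hmeas k)
  · simp only [Set.ofPred_forall, imp_iff_not_or, Set.ofPred_or]
    exact .iInter fun k => (hmeas k).compl.union (MeasurableSet.const _)

variable [IsProbabilityMeasure μ]

theorem ae_finite_arrivals {K : ℝ} {t : ℝ}
    (htail : ∀ k, μ.real {ω | τ k ω ≤ ENNReal.ofReal t} ≤ K * (1 / 2) ^ k) :
    ∀ᵐ ω ∂μ, {k : ℕ | τ k ω ≤ ENNReal.ofReal t}.Finite := by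
  refine ae_finite_setOfPred_mem (s := fun k => {ω | τ k ω ≤ ENNReal.ofReal t}) ?_
  have hsum : Summable fun k : ℕ => K * (1 / 2 : ℝ) ^ k := summable_geometric_two.mul_left K
  refine ne_top_of_le_ne_top hsum.tsum_ofReal_ne_top (ENNReal.tsum_le_tsum fun k => ?_)
  rw [← ofReal_measureReal]
  exact ENNReal.ofReal_le_ofReal (htail k)

theorem summable_pow_four_mul_half_pow (K : ℝ) :
    Summable fun k : ℕ => (k : ℝ) ^ 4 * (K * (1 / 2) ^ k) := by
  refine ((summable_pow_mul_geometric_of_norm_lt_one (R := ℝ) 4 (r := 1 / 2)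
    (by norm_num)).mul_left K).congr fun k => ?_
  ring

/-- The index `k = Z(t)` alone contributes `Z(t) ^ 4` to `∑ₖ k ^ 4 1{τₖ ≤ t}`, whose mean is
controlled by the geometric tail. -/
theorem lintegral_countingProcess_pow_four_le (h : ∀ k, Measurable (τ k)) {K : ℝ} {t : ℝ}
    (hK : 0 ≤ K) (htail : ∀ k, μ.real {ω | τ k ω ≤ ENNReal.ofReal t} ≤ K * (1 / 2) ^ k) :
    ∫⁻ ω, ENNReal.ofReal ((countingProcess τ t ω : ℝ) ^ 4) ∂μ
      ≤ ENNReal.ofReal (∑' k : ℕ, (k : ℝ) ^ 4 * (K * (1 / 2) ^ k)) := by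
  have hmeas : ∀ k, MeasurableSet {ω | τ k ω ≤ ENNReal.ofReal t} := fun k =>
    measurableSet_le (h k) measurable_const
  calc ∫⁻ ω, ENNReal.ofReal ((countingProcess τ t ω : ℝ) ^ 4) ∂μ
      ≤ ∫⁻ ω, ∑' k : ℕ, {ω | τ k ω ≤ ENNReal.ofReal t}.indicator
          (fun _ => ENNReal.ofReal ((k : ℝ) ^ 4)) ω ∂μ := by
        refine lintegral_mono fun ω => ?_
        rcases countingProcess_eq_zero_or_le τ t ω with h0 | h0
        · simp [h0]
        · refine le_trans (le_of_eq ?_) (ENNReal.le_tsum (countingProcess τ t ω))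
          rw [Set.indicator_of_mem (by exact h0)]
    _ = ∑' k : ℕ, ENNReal.ofReal ((k : ℝ) ^ 4) * μ {ω | τ k ω ≤ ENNReal.ofReal t} := by
        rw [lintegral_tsum fun k => (measurable_const.indicator (hmeas k)).aemeasurable]
        exact tsum_congr fun k => lintegral_indicator_const (hmeas k) _
    _ ≤ ∑' k : ℕ, ENNReal.ofReal ((k : ℝ) ^ 4 * (K * (1 / 2) ^ k)) := by
        refine ENNReal.tsum_le_tsum fun k => ?_
        rw [ENNReal.ofReal_mul (by positivity), ← ofReal_measureReal]
        gcongr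
        exact htail k
    _ = _ := (ENNReal.ofReal_tsum_of_nonneg (fun k => by positivity)
        (summable_pow_four_mul_half_pow K)).symm

theorem integrable_countingProcess_pow_four (h : ∀ k, Measurable (τ k)) {K : ℝ} {t : ℝ}
    (hK : 0 ≤ K) (htail : ∀ k, μ.real {ω | τ k ω ≤ ENNReal.ofReal t} ≤ K * (1 / 2) ^ k) :
    Integrable (fun ω => (countingProcess τ t ω : ℝ) ^ 4) μ := by
  refine ⟨?_, ?_⟩
  · exact (((measurable_from_nat (f := fun n : ℕ => (n : ℝ))).comp
      (measurable_countingProcess h t)).pow_const 4).aestronglyMeasurable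
  · rw [hasFiniteIntegral_iff_ofReal (Eventually.of_forall fun ω => by positivity)]
    exact (lintegral_countingProcess_pow_four_le h hK htail).trans_lt ENNReal.ofReal_lt_top

theorem integral_countingProcess_pow_four_le (h : ∀ k, Measurable (τ k)) {K : ℝ} {t : ℝ}
    (hK : 0 ≤ K) (htail : ∀ k, μ.real {ω | τ k ω ≤ ENNReal.ofReal t} ≤ K * (1 / 2) ^ k) :
    ∫ ω, (countingProcess τ t ω : ℝ) ^ 4 ∂μ ≤ ∑' k : ℕ, (k : ℝ) ^ 4 * (K * (1 / 2) ^ k) := by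
  have hle := lintegral_countingProcess_pow_four_le h hK htail
  rw [← ofReal_integral_eq_lintegral_ofReal (integrable_countingProcess_pow_four h hK htail)
    (Eventually.of_forall fun ω => by positivity)] at hle
  exact (ENNReal.ofReal_le_ofReal_iff (tsum_nonneg fun k => by positivity)).1 hle

theorem memLp_countingProcess (h : ∀ k, Measurable (τ k)) {K : ℝ} {t : ℝ}
    (hK : 0 ≤ K) (htail : ∀ k, μ.real {ω | τ k ω ≤ ENNReal.ofReal t} ≤ K * (1 / 2) ^ k) :
    MemLp (fun ω => (countingProcess τ t ω : ℝ)) 4 μ := by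
  have hm : AEStronglyMeasurable (fun ω => (countingProcess τ t ω : ℝ)) μ :=
    ((measurable_from_nat (f := fun n : ℕ => (n : ℝ))).comp
      (measurable_countingProcess h t)).aestronglyMeasurable
  refine (integrable_norm_rpow_iff hm (by norm_num) (by norm_num)).1 ?_
  refine (integrable_countingProcess_pow_four h hK htail).congr (Eventually.of_forall fun ω => ?_)
  simp only [Real.norm_natCast, ENNReal.toReal_ofNat]
  exact (Real.rpow_natCast _ 4).symm

/-- Sum the short-interval estimate over `k`; the geometric tail contributes `∑ₖ K 2⁻ᵏ = 2 * K`. -/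
theorem IsLastArrivalDependent.integral_countingIncrement_le
    (h : IsLastArrivalDependent μ T w τ)
    (hw : ContinuousOn (fun p : ℝ × ℝ => w p.1 p.2) (timeTriangle T))
    (hw0 : ∀ p ∈ timeTriangle T, 0 ≤ w p.1 p.2)
    (hwC : ∀ p ∈ timeTriangle T, w p.1 p.2 ≤ C) (hC : 0 ≤ C) {K : ℝ} (hK : 0 ≤ K)
    (htail : ∀ t ≤ T, ∀ k, μ.real {ω | τ k ω ≤ ENNReal.ofReal t} ≤ K * (1 / 2) ^ k)
    {s t : ℝ} (hs : 0 ≤ s) (hst : s ≤ t) (htT : t ≤ T) :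
    ∫ ω, countingIncrement τ s t ω ∂μ ≤ C * (t - s) * (2 * K) := by
  have hts : 0 ≤ t - s := sub_nonneg.2 hst
  have hint : Integrable (countingIncrement τ s t) μ :=
    ((memLp_countingProcess h.measurable hK (htail t htT)).integrable (by norm_num)).sub
      ((memLp_countingProcess h.measurable hK (htail s (hst.trans htT))).integrable (by norm_num))
  have hfin := ae_finite_arrivals (htail t htT)
  have hnn : 0 ≤ᵐ[μ] countingIncrement τ s t := by
    filter_upwards [hfin] with ω hω
    exact sub_nonneg.2 (Nat.cast_le.2 (countingProcess_mono hst hω))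
  have hmeas : ∀ k, MeasurableSet
      {ω | ENNReal.ofReal s < τ (k + 1) ω ∧ τ (k + 1) ω ≤ ENNReal.ofReal t} := fun k =>
    (measurableSet_lt measurable_const (h.measurable _)).inter
      (measurableSet_le (h.measurable _) measurable_const)
  have hsum : Summable fun k : ℕ => C * (t - s) * (K * (1 / 2 : ℝ) ^ k) :=
    (summable_geometric_two.mul_left K).mul_left _
  have htsum : ∑' k : ℕ, C * (t - s) * (K * (1 / 2 : ℝ) ^ k) = C * (t - s) * (2 * K) := by
    rw [tsum_mul_left, tsum_mul_left, tsum_geometric_two, mul_comm K]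
  rw [← ENNReal.ofReal_le_ofReal_iff (by positivity),
    ofReal_integral_eq_lintegral_ofReal hint hnn]
  calc ∫⁻ ω, ENNReal.ofReal (countingIncrement τ s t ω) ∂μ
      ≤ ∫⁻ ω, ∑' k : ℕ, {ω | ENNReal.ofReal s < τ (k + 1) ω ∧
          τ (k + 1) ω ≤ ENNReal.ofReal t}.indicator (fun _ => (1 : ℝ≥0∞)) ω ∂μ := by
        refine lintegral_mono_ae ?_
        filter_upwards [hfin, h.mono] with ω hω hm
        exact ofReal_countingIncrement_le hst hm hω
    _ = ∑' k : ℕ, μ {ω | ENNReal.ofReal s < τ (k + 1) ω ∧ τ (k + 1) ω ≤ ENNReal.ofReal t} := by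
        rw [lintegral_tsum fun k => (measurable_const.indicator (hmeas k)).aemeasurable]
        exact tsum_congr fun k => by rw [lintegral_indicator_const (hmeas k), one_mul]
    _ ≤ ∑' k : ℕ, ENNReal.ofReal (C * (t - s) * (K * (1 / 2) ^ k)) := by
        refine ENNReal.tsum_le_tsum fun k => ?_
        rw [← ofReal_measureReal]
        refine ENNReal.ofReal_le_ofReal
          ((h.measureReal_Ioc_le hw hw0 hwC hC k hs hst htT).trans ?_)
        gcongr
        exact htail t htT k
    _ = ENNReal.ofReal (C * (t - s) * (2 * K)) := by
        rw [← ENNReal.ofReal_tsum_of_nonneg (fun k => by positivity) hsum, htsum]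

/-- The tail bound depends on the horizon and on the bound of the intensity only. -/
theorem exists_tail_bound (hT : 0 < T) (hC : 0 ≤ C) :
    ∃ K : ℝ, 0 ≤ K ∧ ∀ {Ω : Type*} [MeasurableSpace Ω] (μ : Measure Ω) [IsProbabilityMeasure μ]
      (w : ℝ → ℝ → ℝ) (τ : ℕ → Ω → ℝ≥0∞), IsLastArrivalDependent μ T w τ →
      ContinuousOn (fun p : ℝ × ℝ => w p.1 p.2) (timeTriangle T) →
      (∀ p ∈ timeTriangle T, 0 ≤ w p.1 p.2) → (∀ p ∈ timeTriangle T, w p.1 p.2 ≤ C) →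
      ∀ t ≤ T, ∀ k, μ.real {ω | τ k ω ≤ ENNReal.ofReal t} ≤ K * (1 / 2) ^ k := by
  -- With `M` cells of length `T / M`, the intensity mass per cell is at most `1 / 4`, and `T` is
  -- the grid point `M`, so `K = 2 ^ M`.
  obtain ⟨M, hM⟩ := exists_nat_gt (4 * (C * T))
  have hM0 : (0 : ℝ) < M := lt_of_le_of_lt (by positivity) hM
  refine ⟨2 ^ M, by positivity, fun μ _ w τ h hw hw0 hwC t ht k => ?_⟩
  have hgrid : (M : ℝ) * (T / M) = T := by field_simp
  have hle := h.measureReal_le_grid hw hw0 hwC hC (δ := T / M) (by positivity)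
    (by rw [← mul_div_assoc, div_le_iff₀ hM0]; linarith) k M hgrid.le
  rw [hgrid] at hle
  exact (measureReal_mono fun ω hω => le_trans hω (ENNReal.ofReal_le_ofReal ht)).trans hle

end CountingProcess

/-! ### A fourth-moment strong law for row-wise independent arrays. -/

section FourthMoment

variable {Ω : Type*} [MeasurableSpace Ω] {μ : Measure Ω} [IsProbabilityMeasure μ]

theorem integrable_pow_of_memLp_four {X : Ω → ℝ} (hX : MemLp X 4 μ) {n : ℕ} (hn : n ≤ 4) :
    Integrable (fun ω => X ω ^ n) μ := by
  have hXn : MemLp X n μ := hX.mono_exponent (by exact_mod_cast hn)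
  refine (integrable_norm_iff (hX.1.pow n)).1 (hXn.integrable_norm_pow'.congr ?_)
  exact Eventually.of_forall fun ω => (norm_pow _ _).symm

/-- The second and fourth moments of the sum of two independent centred random variables. -/
theorem integral_add_sq_and_pow_four {S X : Ω → ℝ} (hS : MemLp S 4 μ) (hX : MemLp X 4 μ)
    (hSX : IndepFun S X μ) (hS0 : ∫ ω, S ω ∂μ = 0) (hX0 : ∫ ω, X ω ∂μ = 0) :
    ∫ ω, (S ω + X ω) ^ 2 ∂μ = ∫ ω, S ω ^ 2 ∂μ + ∫ ω, X ω ^ 2 ∂μ ∧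
    ∫ ω, (S ω + X ω) ^ 4 ∂μ = ∫ ω, S ω ^ 4 ∂μ
      + 6 * ((∫ ω, S ω ^ 2 ∂μ) * ∫ ω, X ω ^ 2 ∂μ) + ∫ ω, X ω ^ 4 ∂μ := by
  have hind : ∀ a b : ℕ, IndepFun (fun ω => S ω ^ a) (fun ω => X ω ^ b) μ := fun a b =>
    hSX.comp (φ := fun x => x ^ a) (ψ := fun x => x ^ b)
      (measurable_id.pow_const a) (measurable_id.pow_const b)
  have hi : ∀ a b : ℕ, a ≤ 4 → b ≤ 4 → Integrable (fun ω => S ω ^ a * X ω ^ b) μ :=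
    fun a b ha hb => (hind a b).integrable_mul (integrable_pow_of_memLp_four hS ha)
      (integrable_pow_of_memLp_four hX hb)
  have hmul : ∀ a b : ℕ, ∫ ω, S ω ^ a * X ω ^ b ∂μ = (∫ ω, S ω ^ a ∂μ) * ∫ ω, X ω ^ b ∂μ :=
    fun a b => (hind a b).integral_fun_mul_eq_mul_integral (hS.1.pow a) (hX.1.pow b)
  have hS1 : ∫ ω, S ω ^ 1 ∂μ = 0 := by simpa using hS0
  have hX1 : ∫ ω, X ω ^ 1 ∂μ = 0 := by simpa using hX0
  have hi2S := integrable_pow_of_memLp_four hS (n := 2) (by norm_num)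
  have hi2X := integrable_pow_of_memLp_four hX (n := 2) (by norm_num)
  have hi4S := integrable_pow_of_memLp_four hS (n := 4) le_rfl
  have hi4X := integrable_pow_of_memLp_four hX (n := 4) le_rfl
  constructor
  · have hexp : (fun ω => (S ω + X ω) ^ 2)
        = fun ω => S ω ^ 2 + 2 * (S ω ^ 1 * X ω ^ 1) + X ω ^ 2 := by
      funext ω; ring
    have hi11 := (hi 1 1 (by norm_num) (by norm_num)).const_mul 2
    rw [hexp, integral_add (hi2S.fun_add hi11) hi2X, integral_add hi2S hi11, integral_const_mul,
      hmul, hS1]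
    ring
  · have hexp : (fun ω => (S ω + X ω) ^ 4) = fun ω => S ω ^ 4 + 4 * (S ω ^ 3 * X ω ^ 1)
        + 6 * (S ω ^ 2 * X ω ^ 2) + 4 * (S ω ^ 1 * X ω ^ 3) + X ω ^ 4 := by
      funext ω; ring
    have hi31 := (hi 3 1 (by norm_num) (by norm_num)).const_mul 4
    have hi22 := (hi 2 2 (by norm_num) (by norm_num)).const_mul 6
    have hi13 := (hi 1 3 (by norm_num) (by norm_num)).const_mul 4
    rw [hexp, integral_add (((hi4S.fun_add hi31).fun_add hi22).fun_add hi13) hi4X,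
      integral_add ((hi4S.fun_add hi31).fun_add hi22) hi13, integral_add (hi4S.fun_add hi31) hi22,
      integral_add hi4S hi31, integral_const_mul, integral_const_mul, integral_const_mul,
      hmul, hmul, hmul, hS1, hX1]
    ring

/-- The second moment is carried through the induction because the cross term of the fourth moment
needs it. -/
theorem integral_sum_sq_and_pow_four_le {ι : Type*} {X : ι → Ω → ℝ} {B : ℝ} (hB : 1 ≤ B)
    (hmeas : ∀ i, Measurable (X i)) (hX : ∀ i, MemLp (X i) 4 μ) (hind : iIndepFun X μ)
    (hX0 : ∀ i, ∫ ω, X i ω ∂μ = 0) (hX4 : ∀ i, ∫ ω, X i ω ^ 4 ∂μ ≤ B) (s : Finset ι) :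
    ∫ ω, (∑ i ∈ s, X i ω) ^ 2 ∂μ ≤ s.card * B ∧
    ∫ ω, (∑ i ∈ s, X i ω) ^ 4 ∂μ ≤ 3 * (s.card * B) ^ 2 := by
  classical
  -- From `x ^ 2 ≤ (1 + x ^ 4) / 2` and `1 ≤ B`.
  have hX2 : ∀ i, ∫ ω, X i ω ^ 2 ∂μ ≤ B := fun i => by
    have hi4 := integrable_pow_of_memLp_four (hX i) (n := 4) le_rfl
    have hle : ∫ ω, X i ω ^ 2 ∂μ ≤ ∫ ω, (1 / 2 + 1 / 2 * X i ω ^ 4) ∂μ :=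
      integral_mono (integrable_pow_of_memLp_four (hX i) (by norm_num))
        ((integrable_const _).add (hi4.const_mul _)) fun ω => by
          nlinarith [sq_nonneg (X i ω ^ 2 - 1)]
    rw [integral_add (integrable_const _) (hi4.const_mul _), integral_const_mul,
      integral_const] at hle
    simp only [probReal_univ, one_smul] at hle
    linarith [hX4 i]
  induction s using Finset.induction_on with
  | empty => simp
  | insert i s his ih =>
    have hS : MemLp (fun ω => ∑ j ∈ s, X j ω) 4 μ := memLp_finsetSum s fun j _ => hX j
    have hSX : IndepFun (fun ω => ∑ j ∈ s, X j ω) (X i) μ := by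
      have := hind.indepFun_finsetSum_of_notMem hmeas his
      rwa [show (∑ j ∈ s, X j) = fun ω => ∑ j ∈ s, X j ω by ext ω; simp] at this
    have hS0 : ∫ ω, ∑ j ∈ s, X j ω ∂μ = 0 := by
      rw [integral_finsetSum s fun j _ => (hX j).integrable (by norm_num)]
      exact Finset.sum_eq_zero fun j _ => hX0 j
    obtain ⟨h2, h4⟩ := integral_add_sq_and_pow_four hS (hX i) hSX hS0 (hX0 i)
    simp only [Finset.sum_insert his, Finset.card_insert_of_notMem his]
    simp only [add_comm (X i _)]
    rw [h2, h4]
    have hprod : (∫ ω, (∑ j ∈ s, X j ω) ^ 2 ∂μ) * ∫ ω, X i ω ^ 2 ∂μ ≤ s.card * B * B :=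
      mul_le_mul ih.1 (hX2 i) (integral_nonneg fun ω => by positivity) (by positivity)
    push_cast
    constructor
    · linarith [ih.1, hX2 i]
    -- With `n = s.card`: `3 (nB)² + 6 nB² + B ≤ 3 ((n + 1) B)²`, because `B ≤ 3 B²`.
    · nlinarith [ih.2, hX4 i]

/-- A strong law of large numbers for triangular arrays of centred random variables with uniformly
bounded fourth moments, with independent rows. -/
theorem ae_tendsto_average_of_pow_four_le {X : (N : ℕ) → Fin N → Ω → ℝ} {B : ℝ} (hB : 1 ≤ B)
    (hmeas : ∀ N i, Measurable (X N i)) (hX : ∀ N i, MemLp (X N i) 4 μ)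
    (hind : ∀ N, iIndepFun (X N) μ) (hX0 : ∀ N i, ∫ ω, X N i ω ∂μ = 0)
    (hX4 : ∀ N i, ∫ ω, X N i ω ^ 4 ∂μ ≤ B) :
    ∀ᵐ ω ∂μ, Tendsto (fun N : ℕ => 1 / (N : ℝ) * ∑ i, X N i ω) atTop (𝓝 0) := by
  set D : ℕ → Ω → ℝ := fun N ω => 1 / (N : ℝ) * ∑ i, X N i ω
  have hDm : ∀ N, Measurable (D N) := fun N =>
    (Finset.measurable_fun_sum _ fun i _ => hmeas N i).const_mul _
  have hint : ∀ N, ∫⁻ ω, ENNReal.ofReal (D N ω ^ 4) ∂μ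
      ≤ ENNReal.ofReal (3 * B ^ 2 * (1 / (N : ℝ) ^ 2)) := fun N => by
    have hS : MemLp (fun ω => ∑ i, X N i ω) 4 μ := memLp_finsetSum _ fun i _ => hX N i
    rw [← ofReal_integral_eq_lintegral_ofReal
      (integrable_pow_of_memLp_four (hS.const_mul _) le_rfl)
      (Eventually.of_forall fun ω => by positivity)]
    refine ENNReal.ofReal_le_ofReal ?_
    simp only [mul_pow]
    rw [integral_const_mul]
    have h4 := (integral_sum_sq_and_pow_four_le hB (hmeas N) (hX N) (hind N) (hX0 N) (hX4 N)
      Finset.univ).2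
    rw [Finset.card_univ, Fintype.card_fin] at h4
    refine (mul_le_mul_of_nonneg_left h4 (by positivity)).trans (le_of_eq ?_)
    rcases eq_or_ne (N : ℝ) 0 with h0 | h0
    · simp [h0]
    · field_simp
  have hsum : Summable fun N : ℕ => 3 * B ^ 2 * (1 / (N : ℝ) ^ 2) :=
    (Real.summable_one_div_nat_pow.2 one_lt_two).mul_left _
  -- Tonelli makes `∑ D N ^ 4` almost surely finite, so its terms tend to zero; no relation between
  -- rows is needed.
  have htsum : ∫⁻ ω, ∑' N, ENNReal.ofReal (D N ω ^ 4) ∂μ ≠ ∞ := by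
    rw [lintegral_tsum fun N => ((hDm N).pow_const 4).ennreal_ofReal.aemeasurable]
    exact ne_top_of_le_ne_top hsum.tsum_ofReal_ne_top (ENNReal.tsum_le_tsum hint)
  filter_upwards [ae_lt_top' (AEMeasurable.tsum fun N =>
    ((hDm N).pow_const 4).ennreal_ofReal.aemeasurable) htsum] with ω hω
  have h4 := ENNReal.tendsto_atTop_zero_of_tsum_ne_top hω.ne
  have h4' : Tendsto (fun N => D N ω ^ 4) atTop (𝓝 0) := by
    have := (ENNReal.tendsto_toReal ENNReal.zero_ne_top).comp h4
    refine (this.congr fun N => ?_)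
    exact ENNReal.toReal_ofReal (by positivity)
  have hsqrt : Tendsto (fun N => √√(D N ω ^ 4)) atTop (𝓝 0) := by
    simpa using h4'.sqrt.sqrt
  refine (tendsto_zero_iff_abs_tendsto_zero _).2 (hsqrt.congr fun N => ?_)
  rw [show D N ω ^ 4 = (D N ω ^ 2) ^ 2 by ring, Real.sqrt_sq (by positivity), Real.sqrt_sq_eq_abs]
  rfl

/-- Centring a nonnegative random variable. -/
theorem integral_sub_integral_pow_four_le {X : Ω → ℝ} {Q : ℝ} (hX : MemLp X 4 μ)
    (hX0 : ∀ ω, 0 ≤ X ω) (hQ : ∫ ω, X ω ^ 4 ∂μ ≤ Q) :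
    ∫ ω, (X ω - ∫ ω', X ω' ∂μ) ^ 4 ∂μ ≤ 8 * (Q + (1 + Q) ^ 4) := by
  have hi4 := integrable_pow_of_memLp_four hX (n := 4) le_rfl
  have hm0 : 0 ≤ ∫ ω, X ω ∂μ := integral_nonneg hX0
  have hm : ∫ ω, X ω ∂μ ≤ 1 + Q := by
    have hle : ∫ ω, X ω ∂μ ≤ ∫ ω, (1 + X ω ^ 4) ∂μ :=
      integral_mono (hX.integrable (by norm_num)) ((integrable_const _).add hi4) fun ω => by
        nlinarith [sq_nonneg (X ω ^ 2 - 1 / 2), sq_nonneg (X ω - 1 / 2)]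
    rw [integral_add (integrable_const _) hi4, integral_const] at hle
    simp only [probReal_univ, one_smul] at hle
    linarith
  set m := ∫ ω, X ω ∂μ
  have hle : ∫ ω, (X ω - m) ^ 4 ∂μ ≤ ∫ ω, (8 * X ω ^ 4 + 8 * m ^ 4) ∂μ := by
    refine integral_mono
      (integrable_pow_of_memLp_four (hX.sub (memLp_const m)) (n := 4) le_rfl)
      ((hi4.const_mul _).add (integrable_const _)) fun ω => ?_
    have h1 : (X ω - m) ^ 2 ≤ 2 * (X ω ^ 2 + m ^ 2) := by nlinarith [sq_nonneg (X ω + m)]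
    have h2 : ((X ω - m) ^ 2) ^ 2 ≤ (2 * (X ω ^ 2 + m ^ 2)) ^ 2 :=
      pow_le_pow_left₀ (sq_nonneg _) h1 2
    show (X ω - m) ^ 4 ≤ 8 * X ω ^ 4 + 8 * m ^ 4
    nlinarith [sq_nonneg (X ω ^ 2 - m ^ 2)]
  rw [integral_add (hi4.const_mul _) (integrable_const _), integral_const_mul,
    integral_const] at hle
  simp only [probReal_univ, one_smul] at hle
  have hm4 : m ^ 4 ≤ (1 + Q) ^ 4 := pow_le_pow_left₀ hm0 hm 4
  linarith

end FourthMoment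

/-! ### From grid points to uniform convergence. -/

/-- Pointwise convergence on equidistant grids of differences of monotone functions and functions
that increase at most linearly is uniform. -/
theorem eventually_forall_abs_sub_le {T L : ℝ} (hT : 0 < T) (hL : 0 ≤ L) {F G : ℕ → ℝ → ℝ}
    (hF : ∀ N s t, 0 ≤ s → s ≤ t → t ≤ T → F N s ≤ F N t)
    (hG : ∀ N s t, 0 ≤ s → s ≤ t → t ≤ T → G N t - G N s ≤ L * (t - s))
    (hlim : ∀ m j : ℕ, j ≤ m →
      Tendsto (fun N => F N (j * (T / m)) - G N (j * (T / m))) atTop (𝓝 0))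
    {ε : ℝ} (hε : 0 < ε) :
    ∀ᶠ N in atTop, ∀ t, 0 ≤ t → t ≤ T → |F N t - G N t| ≤ 2 * ε := by
  -- The mesh is chosen so that `G` rises by at most `ε` within a cell.
  obtain ⟨m, hm⟩ := exists_nat_gt (L * T / ε)
  have hm0 : (0 : ℝ) < m := lt_of_le_of_lt (by positivity) hm
  have hLm : L * (T / m) ≤ ε := by
    rw [div_lt_iff₀ hε] at hm
    rw [← mul_div_assoc, div_le_iff₀ hm0]
    linarith
  have hδ : 0 < T / m := by positivity
  have hgrid : (m : ℝ) * (T / m) = T := by field_simp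
  have hall : ∀ᶠ N in atTop, ∀ j ∈ Finset.range (m + 1),
      |F N (j * (T / m)) - G N (j * (T / m))| ≤ ε := by
    rw [Filter.eventually_all_finset]
    intro j hj
    have := (hlim m j (Nat.lt_succ_iff.1 (Finset.mem_range.1 hj))).abs
    rw [abs_zero] at this
    exact (this.eventually_lt_const hε).mono fun N hN => hN.le
  filter_upwards [hall] with N hN t ht0 htT
  rcases htT.eq_or_lt with rfl | htT
  -- The endpoint is separate: there the floor would be `m`, and `m + 1` lies off the grid.
  · have := hN m (Finset.mem_range.2 (Nat.lt_succ_self m))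
    rw [hgrid] at this
    linarith
  · set j := ⌊t / (T / m)⌋₊
    have hj1 : (j : ℝ) * (T / m) ≤ t := (le_div_iff₀ hδ).1 (Nat.floor_le (by positivity))
    have hj2 : t ≤ ((j + 1 : ℕ) : ℝ) * (T / m) := by
      push_cast
      exact ((div_lt_iff₀ hδ).1 (Nat.lt_floor_add_one _)).le
    have hjm : j < m := by
      have : (j : ℝ) * (T / m) < m * (T / m) := by rw [hgrid]; linarith
      exact_mod_cast lt_of_mul_lt_mul_right this hδ.le
    have hj3 : ((j + 1 : ℕ) : ℝ) * (T / m) ≤ T := by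
      have : ((j + 1 : ℕ) : ℝ) ≤ m := by exact_mod_cast hjm
      exact (mul_le_mul_of_nonneg_right this hδ.le).trans_eq hgrid
    have hj0 : 0 ≤ (j : ℝ) * (T / m) := by positivity
    have hstep : ((j + 1 : ℕ) : ℝ) * (T / m) - j * (T / m) = T / m := by push_cast; ring
    have a1 := abs_le.1 (hN j (Finset.mem_range.2 (by omega)))
    have a2 := abs_le.1 (hN (j + 1) (Finset.mem_range.2 (by omega)))
    have f1 := hF N _ _ hj0 hj1 htT.le
    have f2 := hF N _ _ ht0 hj2 hj3
    have g1 := hG N _ _ hj0 hj1 htT.le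
    have g2 := hG N _ _ ht0 hj2 hj3
    have l1 : L * (t - j * (T / m)) ≤ L * (T / m) := by gcongr; linarith
    have l2 : L * (((j + 1 : ℕ) : ℝ) * (T / m) - t) ≤ L * (T / m) := by gcongr; linarith
    -- Monotonicity moves `F` to the right grid point for the upper bound and to the left one for
    -- the lower bound. One `ε` is the error at the grid point, the other the change of `G`.
    rw [abs_le]
    constructor <;> linarith

/-! ### The uniform law of large numbers. -/

/-- For every `N`, the `N` counting processes with last-arrival-time dependent intensities are
independent as processes on `[0, T]`; nothing is assumed between different `N`. The first two
parts of the conclusion say that the maxima defining the processes and the means exist. -/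
theorem theorem3p1 {Ω : Type*} [MeasurableSpace Ω] (μ : Measure Ω) [IsProbabilityMeasure μ]
    (T : ℝ) (hT : 0 < T)
    (w : (N : ℕ) → Fin N → ℝ → ℝ → ℝ)
    (hw_smooth : ∀ N i, ContDiffOn ℝ 1 (fun p : ℝ × ℝ => w N i p.1 p.2) (timeTriangle T))
    (hw_nonneg : ∀ N i, ∀ p ∈ timeTriangle T, 0 ≤ w N i p.1 p.2)
    (hw_bdd : ∃ C : ℝ, ∀ N i, ∀ p ∈ timeTriangle T, w N i p.1 p.2 ≤ C)
    (τ : (N : ℕ) → Fin N → ℕ → Ω → ℝ≥0∞)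
    (hτ : ∀ N i, IsLastArrivalDependent μ T (w N i) (τ N i))
    (hindep : ∀ N, iIndepFun
      (fun (i : Fin N) (ω : Ω) (t : Set.Icc (0 : ℝ) T) => countingProcess (τ N i) (t : ℝ) ω) μ) :
    (∀ᵐ ω ∂μ, ∀ N i, {k : ℕ | τ N i k ω ≤ ENNReal.ofReal T}.Finite) ∧
    (∀ N i, ∀ t ∈ Set.Icc 0 T, Integrable (fun ω => (countingProcess (τ N i) t ω : ℝ)) μ) ∧
    ∀ᵐ ω ∂μ, Tendsto
      (fun N : ℕ => ⨆ p ∈ timeTriangle T, ENNReal.ofReal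
        |(1 / (N : ℝ)) * ∑ i : Fin N, (countingIncrement (τ N i) p.1 p.2 ω
          - ∫ ω', countingIncrement (τ N i) p.1 p.2 ω' ∂μ)|)
      atTop (𝓝 0) := by
  have hwc : ∀ N i, ContinuousOn (fun p : ℝ × ℝ => w N i p.1 p.2) (timeTriangle T) :=
    fun N i => (hw_smooth N i).continuousOn
  obtain ⟨C, hC, hwC⟩ : ∃ C : ℝ, 0 ≤ C ∧ ∀ N i, ∀ p ∈ timeTriangle T, w N i p.1 p.2 ≤ C := by
    obtain ⟨C, hC⟩ := hw_bdd
    exact ⟨max C 0, le_max_right _ _, fun N i p hp => (hC N i p hp).trans (le_max_left _ _)⟩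
  obtain ⟨K, hK, htail'⟩ := exists_tail_bound hT hC
  have htail : ∀ N i, ∀ t ≤ T, ∀ k,
      μ.real {ω | τ N i k ω ≤ ENNReal.ofReal t} ≤ K * (1 / 2) ^ k := fun N i =>
    htail' μ (w N i) (τ N i) (hτ N i) (hwc N i) (hw_nonneg N i) (hwC N i)
  have hmem : ∀ N i, ∀ t ≤ T, MemLp (fun ω => (countingProcess (τ N i) t ω : ℝ)) 4 μ :=
    fun N i t ht => memLp_countingProcess (hτ N i).measurable hK (htail N i t ht)
  have hinteg : ∀ N i, ∀ t ≤ T, Integrable (fun ω => (countingProcess (τ N i) t ω : ℝ)) μ :=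
    fun N i t ht => (hmem N i t ht).integrable (by norm_num)
  have hfin : ∀ᵐ ω ∂μ, ∀ N i, {k : ℕ | τ N i k ω ≤ ENNReal.ofReal T}.Finite := by
    rw [ae_all_iff]; intro N
    rw [ae_all_iff]; intro i
    exact ae_finite_arrivals (htail N i T le_rfl)
  refine ⟨hfin, fun N i t ht => hinteg N i t ht.2, ?_⟩
  set m : (N : ℕ) → Fin N → ℝ → ℝ := fun N i t => ∫ ω, (countingProcess (τ N i) t ω : ℝ) ∂μ
    with hm
  have hlln : ∀ t ∈ Set.Icc 0 T, ∀ᵐ ω ∂μ, Tendsto (fun N : ℕ =>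
      1 / (N : ℝ) * ∑ i, ((countingProcess (τ N i) t ω : ℝ) - m N i t)) atTop (𝓝 0) := by
    intro t ht
    set Q : ℝ := ∑' k : ℕ, (k : ℝ) ^ 4 * (K * (1 / 2) ^ k)
    have hQ : 0 ≤ Q := tsum_nonneg fun k => by positivity
    refine ae_tendsto_average_of_pow_four_le (B := 8 * (Q + (1 + Q) ^ 4)) ?_ (fun N i => ?_)
      (fun N i => (hmem N i t ht.2).sub (memLp_const _)) (fun N => ?_) (fun N i => ?_)
      fun N i => ?_
    · have : (1 : ℝ) ≤ (1 + Q) ^ 4 := one_le_pow₀ (by linarith)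
      linarith
    · exact (measurable_from_nat.comp
        (measurable_countingProcess (hτ N i).measurable t)).sub_const _
    · exact (hindep N).comp (fun i (z : Set.Icc (0 : ℝ) T → ℕ) => (z ⟨t, ht⟩ : ℝ) - m N i t)
        fun i => (measurable_from_nat.comp (measurable_pi_apply _)).sub_const _
    · rw [integral_sub (hinteg N i t ht.2) (integrable_const _), integral_const]
      simp [hm]
    · exact integral_sub_integral_pow_four_le (hmem N i t ht.2) (fun ω => Nat.cast_nonneg _)
        (integral_countingProcess_pow_four_le (hτ N i).measurable hK (htail N i t ht.2))
  -- All grids share one null set, so the mesh may later depend on the accuracy.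
  have hgrid : ∀ᵐ ω ∂μ, ∀ n j : ℕ, j ≤ n → Tendsto (fun N : ℕ => 1 / (N : ℝ) * ∑ i,
      ((countingProcess (τ N i) (j * (T / n)) ω : ℝ) - m N i (j * (T / n)))) atTop (𝓝 0) := by
    rw [ae_all_iff]; intro n
    rw [ae_all_iff]; intro j
    by_cases hjn : j ≤ n
    · refine (hlln (j * (T / n)) ⟨by positivity, ?_⟩).mono fun ω hω _ => hω
      rw [← mul_div_assoc]
      refine div_le_of_le_mul₀ (by positivity) hT.le ?_
      rw [mul_comm]
      gcongr
    · exact Eventually.of_forall fun ω h => absurd h hjn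
  have hLip : ∀ N i s t, 0 ≤ s → s ≤ t → t ≤ T → m N i t - m N i s ≤ C * (2 * K) * (t - s) := by
    intro N i s t hs hst ht
    have := (hτ N i).integral_countingIncrement_le (hwc N i) (hw_nonneg N i) (hwC N i) hC hK
      (htail N i) hs hst ht
    simp only [countingIncrement] at this
    rw [integral_sub (hinteg N i t ht) (hinteg N i s (hst.trans ht))] at this
    linarith
  filter_upwards [hfin, hgrid] with ω hω hωlim
  have hunif : ∀ ε : ℝ, 0 < ε → ∀ᶠ N : ℕ in atTop, ∀ t, 0 ≤ t → t ≤ T →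
      |1 / (N : ℝ) * ∑ i, (countingProcess (τ N i) t ω : ℝ) - 1 / (N : ℝ) * ∑ i, m N i t|
        ≤ 2 * ε := by
    intro ε hε
    refine eventually_forall_abs_sub_le hT (L := C * (2 * K)) (by positivity)
      (F := fun N t => 1 / (N : ℝ) * ∑ i, (countingProcess (τ N i) t ω : ℝ))
      (G := fun N t => 1 / (N : ℝ) * ∑ i, m N i t) (fun N s t hs hst ht => ?_)
      (fun N s t hs hst ht => ?_) (fun n j hj => ?_) hε
    · refine mul_le_mul_of_nonneg_left (Finset.sum_le_sum fun i _ => ?_) (by positivity)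
      exact Nat.cast_le.2 (countingProcess_mono hst
        ((hω N i).subset fun k hk => le_trans hk (ENNReal.ofReal_le_ofReal ht)))
    · rw [← mul_sub, ← Finset.sum_sub_distrib]
      have hsum := Finset.sum_le_card_nsmul Finset.univ _ _
        fun i _ => hLip N i s t hs hst ht
      rw [Finset.card_univ, Fintype.card_fin, nsmul_eq_mul] at hsum
      have hts : 0 ≤ t - s := sub_nonneg.2 hst
      rcases N.eq_zero_or_pos with rfl | hN
      · simp only [Finset.univ_eq_empty, Finset.sum_empty, mul_zero]; positivity
      · rw [one_div, inv_mul_le_iff₀ (by exact_mod_cast hN)]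
        exact hsum
    · refine (hωlim n j hj).congr fun N => ?_
      rw [← mul_sub, ← Finset.sum_sub_distrib]
  rw [ENNReal.tendsto_nhds_zero]
  intro ε hε
  obtain ⟨r, hr0, hrε⟩ := ENNReal.lt_iff_exists_nnreal_btwn.1 hε
  have hr : (0 : ℝ) < r := by exact_mod_cast hr0
  -- Each of the two endpoints costs `2 * (r / 4)`, which adds up to `r`.
  filter_upwards [hunif (r / 4) (by positivity)] with N hN
  refine iSup₂_le fun p hp => le_trans ?_ hrε.le
  rw [← ENNReal.ofReal_coe_nnreal]
  refine ENNReal.ofReal_le_ofReal ?_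
  have h1 := abs_le.1 (hN p.1 hp.1 (hp.2.1.trans hp.2.2))
  have h2 := abs_le.1 (hN p.2 (hp.1.trans hp.2.1) hp.2.2)
  have heq : (1 / (N : ℝ)) * ∑ i : Fin N, (countingIncrement (τ N i) p.1 p.2 ω
        - ∫ ω', countingIncrement (τ N i) p.1 p.2 ω' ∂μ)
      = (1 / (N : ℝ) * ∑ i, (countingProcess (τ N i) p.2 ω : ℝ) - 1 / (N : ℝ) * ∑ i, m N i p.2)
        - (1 / (N : ℝ) * ∑ i, (countingProcess (τ N i) p.1 ω : ℝ)
          - 1 / (N : ℝ) * ∑ i, m N i p.1) := by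
    simp only [← mul_sub, ← Finset.sum_sub_distrib]
    congr 1
    refine Finset.sum_congr rfl fun i _ => ?_
    simp only [countingIncrement, hm]
    rw [integral_sub (hinteg N i _ hp.2.2) (hinteg N i _ (hp.2.1.trans hp.2.2))]
    ring
  rw [heq, abs_le]
  constructor <;> linarith
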